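/- Let $K$ be a field, let $m,n$ be positive integers, let $S=K[x_{ij} : 1\le i\le m,\ 1\le j\le n]$ and let $X=(x_{ij})$ be the $m\times n$ matrix of variables. Let $I_2(X)\subseteq S$ be the ideal generated by the $2$-minors of $X$. For a total order on the set of variables, the induced reverse lexicographic term order on the monomials of $S$ is the one for which $x^a<x^b$ if and only if $\deg x^a<\deg x^b$, or $\deg x^a=\deg x^b$ and, for the smallest variable whose exponents in $x^a$ and $x^b$ differ, its exponent in $x^a$ is larger than its exponent in $x^b$. Then for every total order on the variables $x_{ij}$, the set of $2$-minors of $X$ is a Gröbner basis of $I_2(X)$ with respect to the induced reverse lexicographic term order; that is, it is a finite set of nonzero elements of $I_2(X)$ whose initial monomials generate the initial ideal $(\operatorname{in}(f) : f\in I_2(X)\setminus\{0\})$. -/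

import Mathlib

/-! ## Degree reverse lexicographic term orders -/

/-- A copy of the exponent vectors `σ →₀ ℕ`, to be ordered by the (degree) reverse lexicographic
order induced by the total order `r` of the variables. -/
def DegRevLex (σ : Type*) (_r : LinearOrder σ) : Type _ := σ →₀ ℕ

namespace DegRevLex

variable {σ : Type*} {r : LinearOrder σ}

noncomputable instance : AddCommMonoid (DegRevLex σ r) :=
  inferInstanceAs (AddCommMonoid (σ →₀ ℕ))

/-- The identity, from exponent vectors to their copy. -/
noncomputable def equiv (σ : Type*) (r : LinearOrder σ) : (σ →₀ ℕ) ≃+ DegRevLex σ r :=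
  AddEquiv.refl _

/-- Exponent vectors are compared first by total degree and then by the *reversed* comparison of
the exponents at the smallest variable (with respect to `r`) at which they differ. -/
noncomputable def key (a : DegRevLex σ r) : ℕ ×ₗ (Lex (σ →₀ ℕ))ᵒᵈ :=
  toLex (Finsupp.degree ((equiv σ r).symm a), OrderDual.toDual (toLex ((equiv σ r).symm a)))

theorem key_injective : Function.Injective (key (σ := σ) (r := r)) := fun _ _ h =>
  congrArg (fun p : ℕ ×ₗ (Lex (σ →₀ ℕ))ᵒᵈ => ofLex (OrderDual.ofDual (ofLex p).2)) h

noncomputable instance : LinearOrder (DegRevLex σ r) :=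
  LinearOrder.lift' key key_injective

/-- `x^a < x^b` iff `deg a < deg b`, or `deg a = deg b` and, for the smallest variable `i` at which
the exponents differ, `x_i` has the larger exponent in `x^a`. -/
theorem lt_iff {a b : σ →₀ ℕ} :
    equiv σ r a < equiv σ r b ↔
      a.degree < b.degree ∨
        (a.degree = b.degree ∧ ∃ i, (∀ j, r.lt j i → a j = b j) ∧ b i < a i) := by
  change key (equiv σ r a) < key (equiv σ r b) ↔ _
  rw [key, key, Prod.Lex.toLex_lt_toLex]
  simp only [AddEquiv.symm_apply_apply, OrderDual.toDual_lt_toDual]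
  refine or_congr Iff.rfl (and_congr Iff.rfl ?_)
  rw [Finsupp.Lex.lt_iff]
  exact exists_congr fun i => and_congr (forall_congr' fun j => imp_congr Iff.rfl eq_comm) Iff.rfl

instance : IsOrderedAddMonoid (DegRevLex σ r) where
  add_le_add_left a b h c := by
    rcases h.eq_or_lt with rfl | h
    · exact le_rfl
    · refine le_of_lt ?_
      obtain ⟨a, rfl⟩ := (equiv σ r).surjective a
      obtain ⟨b, rfl⟩ := (equiv σ r).surjective b
      obtain ⟨c, rfl⟩ := (equiv σ r).surjective c
      rw [← map_add, ← map_add, lt_iff]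
      rw [lt_iff] at h
      simpa using h

theorem equiv_monotone : Monotone (equiv σ r) := by
  intro a b h
  rcases h.eq_or_lt with rfl | h
  · exact le_rfl
  · obtain ⟨c, rfl⟩ := exists_add_of_le h.le
    refine (lt_iff.2 (Or.inl ?_)).le
    have hc : c ≠ 0 := by
      rintro rfl
      simp at h
    have : c.degree ≠ 0 := by simpa [Finsupp.degree_eq_zero_iff] using hc
    rw [map_add]
    omega

instance [Finite σ] : WellFoundedLT (DegRevLex σ r) := by
  refine ⟨RelEmbedding.wellFounded_iff_isEmpty.2 ⟨fun f => ?_⟩⟩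
  obtain ⟨i, j, hij, hle⟩ :=
    wellQuasiOrdered_le (α := σ →₀ ℕ) (fun k => (equiv σ r).symm (f k))
  have h1 : f i ≤ f j := by simpa using equiv_monotone (r := r) hle
  exact absurd (f.map_rel_iff.2 hij) (not_lt.2 h1)

end DegRevLex

/-- The reverse lexicographic term order on the monomials in finitely many variables indexed by
`σ`, induced by the total order `r` of the variables (`r.lt i j` means `x_i < x_j`). -/
noncomputable def MonomialOrder.degRevLex {σ : Type*} [Finite σ] (r : LinearOrder σ) :
    MonomialOrder σ where
  syn := DegRevLex σ r
  toSyn := DegRevLex.equiv σ r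
  toSyn_monotone := DegRevLex.equiv_monotone

/-! ## Initial ideals and Gröbner bases over a field -/

section Groebner

variable {σ K : Type*} [Field K]

/-- The initial monomial `in(f)`: the largest monomial that appears in `f` (meaningful for
`f ≠ 0`). -/
noncomputable def MonomialOrder.initialMonomial (ord : MonomialOrder σ) (f : MvPolynomial σ K) :
    MvPolynomial σ K :=
  MvPolynomial.monomial (ord.degree f) 1

/-- The initial ideal `in(I) = (in(f) : f ∈ I \ {0})`. -/
noncomputable def MonomialOrder.initialIdeal (ord : MonomialOrder σ)
    (I : Ideal (MvPolynomial σ K)) : Ideal (MvPolynomial σ K) :=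
  Ideal.span {g | ∃ f ∈ I, f ≠ 0 ∧ g = ord.initialMonomial f}

/-- `G` is a Gröbner basis of `I` with respect to `ord`: a finite set of nonzero elements of `I`
whose initial monomials generate the initial ideal of `I`. -/
structure MonomialOrder.IsGroebnerBasis (ord : MonomialOrder σ) (G : Set (MvPolynomial σ K))
    (I : Ideal (MvPolynomial σ K)) : Prop where
  finite : G.Finite
  subset : G ⊆ I
  ne_zero : ∀ g ∈ G, g ≠ 0
  span_eq : Ideal.span (ord.initialMonomial '' G) = ord.initialIdeal I

end Groebner

/-! ## Minors and determinantal ideals -/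

/-- The set of `t`-minors of a matrix: the determinants of its `t × t` submatrices, with row and
column indices taken in increasing order. -/
def Matrix.minorSet {R : Type*} [CommRing R] {m n : ℕ} (t : ℕ) (A : Matrix (Fin m) (Fin n) R) :
    Set R :=
  {f | ∃ (rows : Fin t ↪o Fin m) (cols : Fin t ↪o Fin n), f = (A.submatrix rows cols).det}

/-- The determinantal ideal `I_t(A)`, generated by the `t`-minors of `A`. -/
def Matrix.determinantalIdeal {R : Type*} [CommRing R] {m n : ℕ} (t : ℕ)
    (A : Matrix (Fin m) (Fin n) R) : Ideal R :=
  Ideal.span (A.minorSet t)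

/-!
The ideal `I_2(X)` lies in the kernel of the Segre map `x_ij ↦ y_i z_j`, under which two monomials
have the same image exactly when their exponent arrays have the same row and column sums. Hence,
for `f ≠ 0` in `I_2(X)`, the initial monomial `x^u` shares its image with a smaller monomial `x^v`
of `f`. Let `x_ij` be the smallest variable at which `u` and `v` differ. Then `v` has the larger
entry there, so `x_il` and `x_kj` divide `x^u` for some `l ≠ j` and `k ≠ i` for which both
variables are larger than `x_ij`. Whatever the position of `x_kl` in the order, `x_il x_kj` is then
the initial monomial of the minor `x_ij x_kl - x_il x_kj`, and it divides `x^u`.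
-/

section ToricMap

open MvPolynomial

variable {σ R M : Type*} [CommSemiring R] [AddCommMonoid M]

variable (R) in
/-- The toric map `x^u ↦ t^(φ u)` attached to an additive map `φ` from exponent vectors to a monoid
`M`; its values lie in the monoid algebra of `M`. -/
noncomputable def toricMap (φ : (σ →₀ ℕ) →+ M) : MvPolynomial σ R →ₐ[R] AddMonoidAlgebra R M :=
  AddMonoidAlgebra.mapDomainAlgHom R R φ

theorem toricMap_monomial (φ : (σ →₀ ℕ) →+ M) (u : σ →₀ ℕ) (c : R) :
    toricMap R φ (monomial u c) = AddMonoidAlgebra.single (φ u) c :=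
  AddMonoidAlgebra.mapDomain_single

theorem exists_ne_mem_support_of_toricMap_eq_zero {φ : (σ →₀ ℕ) →+ M} {f : MvPolynomial σ R}
    (hf : toricMap R φ f = 0) {u : σ →₀ ℕ} (hu : u ∈ f.support) :
    ∃ v ∈ f.support, v ≠ u ∧ φ v = φ u := by
  by_contra! h
  have hcoeff : (toricMap R φ f).coeff (φ u) = f.coeff u := by
    rw [f.as_sum, map_sum, AddMonoidAlgebra.coeff_sum, Finsupp.finsetSum_apply,
      Finset.sum_eq_single_of_mem u hu]
    · simp [toricMap_monomial]
    · intro v hv hvu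
      simp [toricMap_monomial, h v hv hvu]
  rw [hf] at hcoeff
  exact mem_support_iff.1 hu hcoeff.symm

end ToricMap

section ExponentVectors

theorem exists_lt_of_mapDomain_eq {α β N : Type*} [AddCommMonoid N] [LinearOrder N]
    [IsOrderedCancelAddMonoid N] {f : α → β} {u v : α →₀ N}
    (h : v.mapDomain f = u.mapDomain f) {a : α} (ha : u a < v a) :
    ∃ b, f b = f a ∧ v b < u b := by
  classical
  by_contra! hle
  let s := (u.support ∪ v.support).filter (f · = f a)
  have hsum (w : α →₀ N) (hw : w.support ⊆ u.support ∪ v.support) :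
      w.mapDomain f (f a) = ∑ b ∈ s, w b := by
    rw [Finsupp.mapDomain_apply_eq_sum]
    exact Finset.sum_subset (Finset.filter_subset_filter _ hw) (by simp_all [s])
  have has : a ∈ s := by
    simp only [s, Finset.mem_filter, Finset.mem_union, Finsupp.mem_support_iff, and_true]
    by_contra! h0
    exact ha.ne (h0.1.trans h0.2.symm)
  have hlt : ∑ b ∈ s, u b < ∑ b ∈ s, v b :=
    Finset.sum_lt_sum (fun b hb => hle b (Finset.mem_filter.1 hb).2) ⟨a, has, ha⟩
  rw [← hsum u Finset.subset_union_left, ← hsum v Finset.subset_union_right, h] at hlt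
  exact hlt.false

theorem DegRevLex.equiv_lt_equiv_of_support_gt {σ : Type*} {r : LinearOrder σ}
    {a b : σ →₀ ℕ} (hdeg : a.degree = b.degree) {i : σ} (hi : i ∈ a.support)
    (hb : ∀ j ∈ b.support, r.lt i j) : equiv σ r a < equiv σ r b := by
  let := r
  have hib : i ∉ b.support := fun h => lt_irrefl i (hb i h)
  refine lt_of_not_ge fun hle => hib ?_
  rcases hle.eq_or_lt with heq | hlt
  · rwa [(equiv σ r).injective heq]
  obtain hlt | ⟨-, k, heq, hk⟩ := lt_iff.1 hlt
  · exact absurd hdeg hlt.ne'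
  · rw [Finsupp.mem_support_iff, heq i (hb k <| Finsupp.mem_support_iff.2 (by omega))]
    exact Finsupp.mem_support_iff.1 hi

variable {α β : Type*}

/-- The row sums and the column sums of an array of exponents: the exponents of the `y_i` and of the
`z_j` in its image under the Segre map `x_ij ↦ y_i z_j`. -/
noncomputable def margins (α β : Type*) : (α × β →₀ ℕ) →+ (α →₀ ℕ) × (β →₀ ℕ) :=
  (Finsupp.mapDomain.addMonoidHom Prod.fst).prod (Finsupp.mapDomain.addMonoidHom Prod.snd)

theorem margins_single_add_single_swap (i k : α) (j l : β) :
    margins α β (Finsupp.single (i, j) 1 + Finsupp.single (k, l) 1) =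
      margins α β (Finsupp.single (i, l) 1 + Finsupp.single (k, j) 1) := by
  simp [margins, Finsupp.mapDomain_add, add_comm]

theorem degree_eq_of_margins_eq {u v : α × β →₀ ℕ} (h : margins α β v = margins α β u) :
    v.degree = u.degree := by
  rw [← Finsupp.degree_mapDomain Prod.fst v, ← Finsupp.degree_mapDomain Prod.fst u]
  exact congrArg (fun w => w.1.degree) h

theorem DegRevLex.exists_single_add_single_le {r : LinearOrder (α × β)} {u v : α × β →₀ ℕ}
    (hvu : equiv _ r v < equiv _ r u) (h : margins α β v = margins α β u) :
    ∃ i j k l, r.lt (i, j) (i, l) ∧ r.lt (i, j) (k, j) ∧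
      Finsupp.single (i, l) 1 + Finsupp.single (k, j) 1 ≤ u := by
  let := r
  obtain hlt | ⟨-, ⟨i, j⟩, heq, hij⟩ := lt_iff.1 hvu
  · exact absurd (degree_eq_of_margins_eq h) hlt.ne
  have hgt {p : α × β} (hp : v p < u p) : r.lt (i, j) p := by
    refine lt_of_not_ge fun hle => ?_
    rcases hle.eq_or_lt with rfl | hlt
    · exact hp.asymm hij
    · exact hp.ne (heq p hlt)
  obtain ⟨⟨_, l⟩, ⟨⟩, hl⟩ := exists_lt_of_mapDomain_eq (congrArg Prod.fst h) hij
  obtain ⟨⟨k, _⟩, ⟨⟩, hk⟩ := exists_lt_of_mapDomain_eq (congrArg Prod.snd h) hij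
  have hne : (i, l) ≠ (k, j) := by
    rintro ⟨⟩
    exact hl.asymm hij
  refine ⟨i, j, k, l, hgt hl, hgt hk, fun p => ?_⟩
  simp only [Finsupp.add_apply, Finsupp.single_apply]
  grind

end ExponentVectors

section TermOrders

open MvPolynomial

variable {σ : Type*} {ord : MonomialOrder σ}

theorem degree_monomial_one_sub_monomial_one {R : Type*} [CommRing R] [Nontrivial R]
    {a b : σ →₀ ℕ} (h : ord.toSyn a < ord.toSyn b) :
    ord.degree (monomial a (1 : R) - monomial b 1) = b := by
  classical
  rw [← neg_sub, ord.degree_neg, MonomialOrder.degree_sub_of_lt] <;>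
    simp [MonomialOrder.degree_monomial, h]

theorem isGroebnerBasis_of_forall_exists_degree_le {K : Type*} [Field K]
    {G : Set (MvPolynomial σ K)} {I : Ideal (MvPolynomial σ K)} (hfin : G.Finite) (hG : G ⊆ I)
    (hG0 : ∀ g ∈ G, g ≠ 0)
    (h : ∀ f ∈ I, f ≠ 0 → ∃ g ∈ G, ord.degree g ≤ ord.degree f) : ord.IsGroebnerBasis G I := by
  refine ⟨hfin, hG, hG0, le_antisymm (Ideal.span_mono ?_) (Ideal.span_le.2 ?_)⟩
  · rintro _ ⟨g, hg, rfl⟩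
    exact ⟨g, hG hg, hG0 g hg, rfl⟩
  · rintro _ ⟨f, hf, hf0, rfl⟩
    obtain ⟨g, hg, hle⟩ := h f hf hf0
    exact Ideal.mem_of_dvd _ (monomial_dvd_monomial.2 ⟨Or.inr hle, dvd_rfl⟩)
      (Ideal.subset_span (Set.mem_image_of_mem _ hg))

end TermOrders

section Minors

open MvPolynomial

variable {m n t : ℕ} {R : Type*} [CommRing R]

theorem finite_minorSet (t : ℕ) (A : Matrix (Fin m) (Fin n) R) : (A.minorSet t).Finite := by
  have : Finite (Fin t ↪o Fin m) := DFunLike.finite _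
  have : Finite (Fin t ↪o Fin n) := DFunLike.finite _
  refine (Set.finite_range fun p : (Fin t ↪o Fin m) × (Fin t ↪o Fin n) =>
    (A.submatrix p.1 p.2).det).subset ?_
  rintro _ ⟨rows, cols, rfl⟩
  exact ⟨(rows, cols), rfl⟩

theorem exists_orderEmbedding_comp_perm {ι : Type*} [LinearOrder ι] {f : Fin t → ι}
    (hf : Function.Injective f) : ∃ (g : Fin t ↪o ι) (π : Equiv.Perm (Fin t)), f = g ∘ π :=
  ⟨OrderEmbedding.ofStrictMono (f ∘ Tuple.sort f)
      ((Tuple.monotone_sort f).strictMono_of_injective (hf.comp (Tuple.sort f).injective)),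
    (Tuple.sort f)⁻¹, by ext; simp⟩

theorem det_submatrix_mem_minorSet_or_neg_mem (A : Matrix (Fin m) (Fin n) R) {rows : Fin t → Fin m}
    {cols : Fin t → Fin n} (hrows : Function.Injective rows) (hcols : Function.Injective cols) :
    (A.submatrix rows cols).det ∈ A.minorSet t ∨ -(A.submatrix rows cols).det ∈ A.minorSet t := by
  obtain ⟨rows, π, rfl⟩ := exists_orderEmbedding_comp_perm hrows
  obtain ⟨cols, ρ, rfl⟩ := exists_orderEmbedding_comp_perm hcols
  have hdet : (A.submatrix (rows ∘ π) (cols ∘ ρ)).det =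
      ((Equiv.Perm.sign π * Equiv.Perm.sign ρ : ℤˣ) : ℤ) * (A.submatrix rows cols).det := by
    rw [Units.val_mul, Int.cast_mul, mul_assoc, ← Matrix.det_permute', ← Matrix.det_permute]
    rfl
  rcases Int.units_eq_one_or (Equiv.Perm.sign π * Equiv.Perm.sign ρ) with h | h
  · exact Or.inl ⟨rows, cols, by simp [hdet, h]⟩
  · exact Or.inr ⟨rows, cols, by simp [hdet, h]⟩

theorem det_submatrix_mvPolynomialX_ne_zero [Nontrivial R] {ι α β : Type*}
    [Fintype ι] [DecidableEq ι] {rows : ι → α} {cols : ι → β}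
    (hrows : Function.Injective rows) (hcols : Function.Injective cols) :
    ((Matrix.mvPolynomialX α β R).submatrix rows cols).det ≠ 0 := by
  have hrename : (Matrix.mvPolynomialX α β R).submatrix rows cols =
      (rename (Prod.map rows cols)).mapMatrix (Matrix.mvPolynomialX ι ι R) := by
    ext1 i j
    simp
  rw [hrename, ← AlgHom.map_det]
  exact (map_ne_zero_iff _ (rename_injective _ (hrows.prodMap hcols))).2
    (Matrix.det_mvPolynomialX_ne_zero ι R)

theorem det_submatrix_two_mvPolynomialX {α β : Type*} (rows : Fin 2 → α) (cols : Fin 2 → β) :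
    ((Matrix.mvPolynomialX α β R).submatrix rows cols).det =
      monomial (Finsupp.single (rows 0, cols 0) 1 + Finsupp.single (rows 1, cols 1) 1) 1 -
        monomial (Finsupp.single (rows 0, cols 1) 1 + Finsupp.single (rows 1, cols 0) 1) 1 := by
  simp [Matrix.det_fin_two, X, monomial_mul]

theorem determinantalIdeal_two_le_ker_toricMap :
    (Matrix.mvPolynomialX (Fin m) (Fin n) R).determinantalIdeal 2 ≤
      RingHom.ker (toricMap R (margins (Fin m) (Fin n))) := by
  refine Ideal.span_le.2 ?_
  rintro _ ⟨rows, cols, rfl⟩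
  rw [SetLike.mem_coe, RingHom.mem_ker, det_submatrix_two_mvPolynomialX, map_sub,
    toricMap_monomial, toricMap_monomial, margins_single_add_single_swap, sub_self]

theorem degree_degRevLex_two_minor [Nontrivial R] {α β : Type*} [Finite (α × β)]
    {r : LinearOrder (α × β)} {i k : α} {j l : β}
    (hrow : r.lt (i, j) (i, l)) (hcol : r.lt (i, j) (k, j)) :
    (MonomialOrder.degRevLex r).degree
        ((Matrix.mvPolynomialX α β R).submatrix ![i, k] ![j, l]).det =
      Finsupp.single (i, l) 1 + Finsupp.single (k, j) 1 := by
  rw [det_submatrix_two_mvPolynomialX]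
  refine degree_monomial_one_sub_monomial_one
    (DegRevLex.equiv_lt_equiv_of_support_gt (i := (i, j)) (by simp) (by simp) fun p hp => ?_)
  have hp' : p = (i, l) ∨ p = (k, j) := by
    by_contra! hne
    simp [hne.1.symm, hne.2.symm] at hp
  rcases hp' with rfl | rfl
  exacts [hrow, hcol]

theorem exists_mem_minorSet_two_degree_le {r : LinearOrder (Fin m × Fin n)}
    {f : MvPolynomial (Fin m × Fin n) R}
    (hf : f ∈ (Matrix.mvPolynomialX (Fin m) (Fin n) R).determinantalIdeal 2) (hf0 : f ≠ 0) :
    ∃ g ∈ (Matrix.mvPolynomialX (Fin m) (Fin n) R).minorSet 2,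
      (MonomialOrder.degRevLex r).degree g ≤ (MonomialOrder.degRevLex r).degree f := by
  have : Nontrivial R := by
    by_contra! _
    exact hf0 (Subsingleton.elim f 0)
  set ord := MonomialOrder.degRevLex r
  obtain ⟨v, hv, hne, hmargins⟩ := exists_ne_mem_support_of_toricMap_eq_zero
    (determinantalIdeal_two_le_ker_toricMap hf) (ord.degree_mem_support hf0)
  have hlt : ord.toSyn v < ord.toSyn (ord.degree f) :=
    (ord.le_degree hv).lt_of_ne (ord.toSyn.injective.ne hne)
  obtain ⟨i, j, k, l, hrow, hcol, hle⟩ := DegRevLex.exists_single_add_single_le hlt hmargins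
  rw [← degree_degRevLex_two_minor (R := R) hrow hcol] at hle
  have hik : Function.Injective ![i, k] :=
    injective_pair_iff_ne.2 (by simpa using @ne_of_lt _ r.toPreorder _ _ hcol)
  have hjl : Function.Injective ![j, l] :=
    injective_pair_iff_ne.2 (by simpa using @ne_of_lt _ r.toPreorder _ _ hrow)
  rcases det_submatrix_mem_minorSet_or_neg_mem (Matrix.mvPolynomialX _ _ R) hik hjl with h | h
  · exact ⟨_, h, hle⟩
  · exact ⟨_, h, by rwa [ord.degree_neg]⟩

end Minors

theorem proposition5p9 {K : Type*} [Field K] (m n : ℕ) (r : LinearOrder (Fin m × Fin n)) :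
    (MonomialOrder.degRevLex r).IsGroebnerBasis
      ((Matrix.mvPolynomialX (Fin m) (Fin n) K).minorSet 2)
      ((Matrix.mvPolynomialX (Fin m) (Fin n) K).determinantalIdeal 2) := by
  refine isGroebnerBasis_of_forall_exists_degree_le (finite_minorSet 2 _) Ideal.subset_span ?_
    fun f hf hf0 => exists_mem_minorSet_two_degree_le hf hf0
  rintro _ ⟨rows, cols, rfl⟩
  exact det_submatrix_mvPolynomialX_ne_zero rows.injective cols.injective
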